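/- Let $G$ be a (finite-dimensional, real) Lie group, with its real analytic structure, with identity $e$ and Lie algebra $\mathfrak g$, and let $(\pi,V)$ be a unitary representation of $G$, i.e. a strongly continuous homomorphism from $G$ to the unitary group of a complex Hilbert space $V$ with inner product $(\cdot,\cdot)$. Let $\mathcal B^1(V)$ be the space of trace class operators on $V$. For a continuous function $f$ on $G$, let $\operatorname{WF}_e(f)\subset i\mathfrak g^*$ and $\operatorname{SS}_e(f)\subset i\mathfrak g^*$ be the fibres over $e$ of the wave front set and of the singular spectrum (analytic wave front set) of $f$. They are computed in a real analytic chart at $e$, with values in $W=\mathbb R^n$, as follows. Write $\mathcal F[v](\xi)=(2\pi)^{-n}\int_W v(y)e^{-\langle y,\xi\rangle}\,dy$ for $\xi\in iW^*$, and let $u$ be a continuous function on an open set $X\subset W$ and $x\in X$. The zero covector is always in $\operatorname{WF}_x(u)$ and in $\operatorname{SS}_x(u)$. For $0\neq\xi\in iW^*$: * $\xi\notin\operatorname{WF}_x(u)$ iff there are an open cone $\mathcal C\ni\xi$ in $iW^*$ and $\varphi\in C_c^\infty(X)$ with $\varphi(x)\ne0$ such that for every $N$ the function $|\eta|^N|\mathcal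 F[\varphi u](\eta)|$ is bounded on $\mathcal C$; * $\xi\notin\operatorname{SS}_x(u)$ iff for any $\varphi\in C_c^\infty(X)$ that is real analytic and nonzero near $x$ there are an open set $\Omega\ni\xi$ in $iW^*$ and $\epsilon,C>0$ with $\left|\mathcal F\left[e^{-t|x-\cdot|^2}\varphi u\right](t\eta)\right|\le Ce^{-\epsilon t}$ for all $t>0$ and $\eta\in\Omega$. Define $$\operatorname{WF}(\pi)=\overline{\bigcup_{u,v\in V}\operatorname{WF}_e\big((\pi(g)u,v)\big)},\qquad \operatorname{SS}(\pi)=\overline{\bigcup_{u,v\in V}\operatorname{SS}_e\big((\pi(g)u,v)\big)},$$ $$\widetilde{\operatorname{WF}}(\pi)=\overline{\bigcup_{T\in\mathcal B^1(V)}\operatorname{WF}_e\big(\operatorname{Tr}(\pi(g)T)\big)},\qquad \widetilde{\operatorname{SS}}(\pi)=\overline{\bigcup_{T\in\mathcal B^1(V)}\operatorname{SS}_e\big(\operatorname{Tr}(\pi(g)T)\big)}.$$ Let $\operatorname{WF}^0(\pi)\subset\mathfrak g^*$ be Howe's wave front set: the closure of the union over $T\in\mathcal B^1(V)$ of the classical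 wave front sets at $e$ of $g\mapsto\operatorname{Tr}(\pi(g)T)$, defined as above but with real covectors $\eta\in W^*$ and the integrals $\int_W\varphi(y)u(y)e^{-i\eta(y)}\,dy$, the zero covector again always being included. Then $$\operatorname{WF}(\pi)=\widetilde{\operatorname{WF}}(\pi),\qquad \operatorname{SS}(\pi)=\widetilde{\operatorname{SS}}(\pi),\qquad\text{and}\qquad \operatorname{WF}(\pi)=i\operatorname{WF}^0(\pi).$$ -/

import Mathlib

open scoped Manifold ContDiff

noncomputable section

namespace RepWF

/-! ### Imaginary covectors and the Fourier transform -/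

section Dual

variable (W : Type*) [AddCommGroup W] [Module ℝ W] [TopologicalSpace W]

/-- The real vector space `iW*`: the continuous real-linear functionals on `W` with purely
imaginary values, with the topology (and norm) of the space of continuous linear maps. -/
def ImagDual : Submodule ℝ (W →L[ℝ] ℂ) where
  carrier := {ξ | ∀ w, (ξ w).re = 0}
  add_mem' := by
    intro a b ha hb w
    simp [ha w, hb w]
  zero_mem' := by
    intro w
    simp
  smul_mem' := by
    intro c a ha w
    simp [ha w]

variable {W}

/-- Multiplication by `i`, from the real dual `W*` onto `iW*`. -/
def mulI (ξ : W →L[ℝ] ℝ) : ImagDual W :=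
  ⟨Complex.I • (Complex.ofRealCLM ∘L ξ), by
    intro w
    simp⟩

end Dual

/-- A subset of a real vector space that is stable under multiplication by positive reals. -/
def IsCone {E : Type*} [AddCommGroup E] [Module ℝ E] (C : Set E) : Prop :=
  ∀ v ∈ C, ∀ t : ℝ, 0 < t → t • v ∈ C

section Euclidean

variable {W : Type*} [NormedAddCommGroup W] [InnerProductSpace ℝ W] [FiniteDimensional ℝ W]
  [MeasurableSpace W] [BorelSpace W]

/-- The space `C_c^∞(X)` of smooth complex functions with compact support contained in `X`. -/
def IsTestFunction (X : Set W) (φ : W → ℂ) : Prop :=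
  ContDiff ℝ ∞ φ ∧ HasCompactSupport φ ∧ tsupport φ ⊆ X

/-- The Fourier transform of an integrable function `v` on `W`, as a function on `iW*`:
`ℱ[v](ξ) = (2π)^{-dim W} ∫ v(y) e^{-⟨y, ξ⟩} dy`.  It is normalised so that
`v(y) = ∫ ℱ[v](ξ) e^{⟨y, ξ⟩} dξ`. -/
def imagFourier (v : W → ℂ) (ξ : ImagDual W) : ℂ :=
  (((2 * Real.pi) ^ Module.finrank ℝ W)⁻¹ : ℝ) *
    ∫ y, v y * Complex.exp (-((ξ : W →L[ℝ] ℂ) y))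

/-- `F` is rapidly decaying in `C`: `|F(ξ)| ≤ A_N |ξ|^{-N}` on `C` for every `N`. -/
def RapidlyDecaying (F : ImagDual W → ℂ) (C : Set (ImagDual W)) : Prop :=
  ∀ N : ℕ, ∃ A : ℝ, 0 < A ∧ ∀ ξ ∈ C, ‖ξ‖ ^ N * ‖F ξ‖ ≤ A

/-- The fibre over `x` of the wave front set of the distribution on the open set `X` given by
the (continuous) function `u`.  The zero covector always belongs to it; `ξ ≠ 0` does not
belong to it iff, for some open cone `C` containing `ξ` and some `φ ∈ C_c^∞(X)` with
`φ(x) ≠ 0`, the function `ℱ[φ u]` is rapidly decaying in `C`. -/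
def wavefrontFiber (X : Set W) (u : W → ℂ) (x : W) : Set (ImagDual W) :=
  {ξ | ξ = 0 ∨ ¬ ∃ C : Set (ImagDual W), IsOpen C ∧ IsCone C ∧ ξ ∈ C ∧
    ∃ φ : W → ℂ, IsTestFunction X φ ∧ φ x ≠ 0 ∧ RapidlyDecaying (imagFourier (fun y => φ y * u y)) C}

/-- The Gaussian `𝒢_t(s) = e^{-t s²}`. -/
def gauss (t s : ℝ) : ℝ := Real.exp (-(t * s ^ 2))

/-- The fibre over `x` of the singular spectrum (analytic wave front set, in the form of Bros
and Iagolnitzer) of the distribution on the open set `X` given by the (continuous) function `u`.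
The zero covector always belongs to it; `ξ ≠ 0` does not belong to it iff, for any
`φ ∈ C_c^∞(X)` that is real analytic and nonzero near `x`, there is an open set `Ω` containing `ξ`
such that `ℱ[𝒢_t(|x - ·|) φ u](tη)` is exponentially decaying in `t > 0`, uniformly for
`η ∈ Ω`. -/
def singularFiber (X : Set W) (u : W → ℂ) (x : W) : Set (ImagDual W) :=
  {ξ | ξ = 0 ∨ ¬ ∀ φ : W → ℂ, IsTestFunction X φ → AnalyticAt ℝ φ x → φ x ≠ 0 →
    ∃ Ω : Set (ImagDual W), IsOpen Ω ∧ ξ ∈ Ω ∧ ∃ ε : ℝ, 0 < ε ∧ ∃ A : ℝ, 0 < A ∧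
      ∀ t : ℝ, 0 < t → ∀ η ∈ Ω,
        ‖imagFourier (fun y => (gauss t ‖x - y‖ : ℂ) * φ y * u y) (t • η)‖ ≤
          A * Real.exp (-(ε * t))}

/-- The fibre over `x` of the wave front set in its classical form, with real covectors:
decay of `∫ φ(y) u(y) e^{-i ξ(y)} dy` in an open cone of the real dual. -/
def realWavefrontFiber (X : Set W) (u : W → ℂ) (x : W) : Set (W →L[ℝ] ℝ) :=
  {ξ | ξ = 0 ∨ ¬ ∃ C : Set (W →L[ℝ] ℝ), IsOpen C ∧ IsCone C ∧ ξ ∈ C ∧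
    ∃ φ : W → ℂ, IsTestFunction X φ ∧ φ x ≠ 0 ∧ ∀ N : ℕ, ∃ A : ℝ, 0 < A ∧ ∀ η ∈ C,
      ‖η‖ ^ N * ‖∫ y, φ y * u y * Complex.exp (-(Complex.I * (η y : ℂ)))‖ ≤ A}

end Euclidean

/-! ### Functions on manifolds -/

section Manifold

variable {n : ℕ} {M : Type*} [TopologicalSpace M] [ChartedSpace (EuclideanSpace ℝ (Fin n)) M]

/-- The fibre over `x ∈ M` of the wave front set of a continuous function `f` on a manifold:
read in the chart `ψ` at `x`, and pulled back to `i T_x* M` by the differential of `ψ`. -/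
def WFAt (f : M → ℂ) (x : M) : Set (ImagDual (TangentSpace (𝓡 n) x)) :=
  {ξ | ∃ η ∈ wavefrontFiber (extChartAt (𝓡 n) x).target (fun y => f ((extChartAt (𝓡 n) x).symm y))
      (extChartAt (𝓡 n) x x),
    ∀ v : TangentSpace (𝓡 n) x, (ξ : TangentSpace (𝓡 n) x →L[ℝ] ℂ) v =
      (η : EuclideanSpace ℝ (Fin n) →L[ℝ] ℂ)
        (mfderiv (𝓡 n) 𝓘(ℝ, EuclideanSpace ℝ (Fin n)) (extChartAt (𝓡 n) x) x v)}

/-- The fibre over `x ∈ M` of the singular spectrum of a continuous function `f` on an analytic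
manifold: read in the chart `ψ` at `x`, and pulled back by the differential of `ψ`. -/
def SSAt (f : M → ℂ) (x : M) : Set (ImagDual (TangentSpace (𝓡 n) x)) :=
  {ξ | ∃ η ∈ singularFiber (extChartAt (𝓡 n) x).target (fun y => f ((extChartAt (𝓡 n) x).symm y))
      (extChartAt (𝓡 n) x x),
    ∀ v : TangentSpace (𝓡 n) x, (ξ : TangentSpace (𝓡 n) x →L[ℝ] ℂ) v =
      (η : EuclideanSpace ℝ (Fin n) →L[ℝ] ℂ)
        (mfderiv (𝓡 n) 𝓘(ℝ, EuclideanSpace ℝ (Fin n)) (extChartAt (𝓡 n) x) x v)}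

/-- The wave front set in its classical form at `x ∈ M`, a subset of the real `T_x* M`. -/
def realWFAt (f : M → ℂ) (x : M) : Set (TangentSpace (𝓡 n) x →L[ℝ] ℝ) :=
  {ξ | ∃ η ∈ realWavefrontFiber (extChartAt (𝓡 n) x).target
      (fun y => f ((extChartAt (𝓡 n) x).symm y)) (extChartAt (𝓡 n) x x),
    ∀ v : TangentSpace (𝓡 n) x, ξ v =
      η (mfderiv (𝓡 n) 𝓘(ℝ, EuclideanSpace ℝ (Fin n)) (extChartAt (𝓡 n) x) x v)}

end Manifold

/-! ### Trace class operators -/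

section TraceClass

variable {V : Type*} [NormedAddCommGroup V] [InnerProductSpace ℂ V] [CompleteSpace V]

/-- `T` is of trace class: `∑ ⟨|T| e, e⟩ < ∞` for some orthonormal basis of `V`
(equivalently for every one), where `|T| = (T* T)^{1/2}`. -/
def IsTraceClass (T : V →L[ℂ] V) : Prop :=
  ∃ (w : Set V) (b : HilbertBasis w ℂ V), Summable fun i => (inner ℂ (b i) (CFC.abs T (b i))).re

variable (V) in
/-- The index set of a fixed orthonormal basis of `V`. -/
def basisIndex : Set V := (exists_hilbertBasis ℂ V).choose

variable (V) in
/-- A fixed orthonormal basis of `V`. -/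
def onBasis : HilbertBasis (basisIndex V) ℂ V := (exists_hilbertBasis ℂ V).choose_spec.choose

/-- The trace `∑ ⟨T e, e⟩` of a trace class operator; it does not depend on the basis. -/
def trace (T : V →L[ℂ] V) : ℂ := ∑' i, inner ℂ (onBasis V i) (T (onBasis V i))

end TraceClass

/-! ### Unitary representations -/

section Representation

variable {n : ℕ} {G : Type*} [TopologicalSpace G] [ChartedSpace (EuclideanSpace ℝ (Fin n)) G]
  [Group G] {V : Type*} [NormedAddCommGroup V] [InnerProductSpace ℂ V] [CompleteSpace V]

/-- The matrix coefficient `g ↦ (π(g) u, v)`, linear in `u` and conjugate linear in `v`. -/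
def matrixCoeff (π : G →* unitary (V →L[ℂ] V)) (u v : V) (g : G) : ℂ :=
  inner ℂ v ((π g : V →L[ℂ] V) u)

/-- The function `g ↦ Tr(π(g) T)`. -/
def traceCoeff (π : G →* unitary (V →L[ℂ] V)) (T : V →L[ℂ] V) (g : G) : ℂ :=
  trace ((π g : V →L[ℂ] V) ∘L T)

variable (n) in
/-- The wave front set of `π`, defined by matrix coefficients; a subset of `i𝔤*`. -/
def WF (π : G →* unitary (V →L[ℂ] V)) : Set (ImagDual (GroupLieAlgebra (𝓡 n) G)) :=
  closure (⋃ (u : V) (v : V), WFAt (matrixCoeff π u v) 1)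

variable (n) in
/-- The singular spectrum of `π`, defined by matrix coefficients; a subset of `i𝔤*`. -/
def SS (π : G →* unitary (V →L[ℂ] V)) : Set (ImagDual (GroupLieAlgebra (𝓡 n) G)) :=
  closure (⋃ (u : V) (v : V), SSAt (matrixCoeff π u v) 1)

variable (n) in
/-- The wave front set of `π` defined by the functions `g ↦ Tr(π(g) T)`. -/
def traceWF (π : G →* unitary (V →L[ℂ] V)) : Set (ImagDual (GroupLieAlgebra (𝓡 n) G)) :=
  closure (⋃ (T : V →L[ℂ] V) (_ : IsTraceClass T), WFAt (traceCoeff π T) 1)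

variable (n) in
/-- The singular spectrum of `π` defined by the functions `g ↦ Tr(π(g) T)`. -/
def traceSS (π : G →* unitary (V →L[ℂ] V)) : Set (ImagDual (GroupLieAlgebra (𝓡 n) G)) :=
  closure (⋃ (T : V →L[ℂ] V) (_ : IsTraceClass T), SSAt (traceCoeff π T) 1)

variable (n) in
/-- Howe's wave front set `WF⁰(π)`, a subset of the real dual `𝔤*`. -/
def howeWF (π : G →* unitary (V →L[ℂ] V)) : Set (GroupLieAlgebra (𝓡 n) G →L[ℝ] ℝ) :=
  closure (⋃ (T : V →L[ℂ] V) (_ : IsTraceClass T), realWFAt (traceCoeff π T) 1)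

end Representation

end RepWF

end

/-!
A trace class operator `T` is an absolutely convergent sum of rank-one operators. Hence
`Tr (P T)` is a sum of matrix coefficients of `P`, every matrix coefficient is such a trace, and
`|Tr (K T)| ≤ C ‖K‖` with `C` depending only on `T`.

For a family of functions `y ↦ (P y u, v)`, that `ξ` is a regular covector means that, for one of
countably many choices of cutoff, cone and rate, weighted Fourier integrals of the function are
bounded. For the wave front set this uses that a regular covector stays regular, on a smaller cone,
when the cutoff `φ` is replaced by one with support in `{φ ≠ 0}`. These Fourier integrals are
`(K u, v)` for the Fourier integrals `K` of `P` in the strong operator topology, and those of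
`y ↦ Tr (P y T)` are `Tr (K T)`. If `ξ` is regular for all `u` and `v`, the condensation of
singularities gives a single choice that works for all of them. The norms `‖K‖` are then bounded
by the uniform boundedness principle, so `ξ` is regular for `y ↦ Tr (P y T)`.
-/

open MeasureTheory Filter Topology

namespace RepWF

section UniformBoundedness

variable {𝕜 𝕜₂ E F : Type*} [NontriviallyNormedField 𝕜] [NontriviallyNormedField 𝕜₂]
  [SeminormedAddCommGroup E] [NormedSpace 𝕜 E] [SeminormedAddCommGroup F] [NormedSpace 𝕜₂ F]
  {σ : 𝕜 →+* 𝕜₂}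

/-- The subspace of vectors on which a family of operators is bounded. -/
def boundedVectors {ι : Type*} (T : ι → E →SL[σ] F) : Submodule 𝕜 E where
  carrier := {x | ∃ M : ℝ, ∀ α, ‖T α x‖ ≤ M}
  add_mem' := by
    rintro x y ⟨M, hM⟩ ⟨M', hM'⟩
    refine ⟨M + M', fun α => ?_⟩
    rw [map_add]
    exact norm_add_le_of_le (hM α) (hM' α)
  zero_mem' := ⟨0, fun α => by simp⟩
  smul_mem' := by
    rintro c x ⟨M, hM⟩
    refine ⟨‖σ c‖ * M, fun α => ?_⟩
    rw [map_smulₛₗ, norm_smul]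
    exact mul_le_mul_of_nonneg_left (hM α) (norm_nonneg _)

variable [RingHomIsometric σ] [CompleteSpace E]

theorem eventually_residual_notMem_boundedVectors {ι : Type*} {T : ι → E →SL[σ] F}
    (hT : ∀ M : ℝ, ∃ α, M < ‖T α‖) : ∀ᶠ x in residual E, x ∉ boundedVectors T := by
  have hne_top : boundedVectors T ≠ ⊤ := fun htop => by
    obtain ⟨M, hM⟩ := banach_steinhaus fun x => (htop ▸ Submodule.mem_top : x ∈ boundedVectors T)
    obtain ⟨α, hα⟩ := hT M
    exact (hM α).not_gt hα
  have hresidual : ∀ m : ℕ, {x | ∀ α, ‖T α x‖ ≤ m}ᶜ ∈ residual E := fun m => by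
    have hclosed : IsClosed {x | ∀ α, ‖T α x‖ ≤ m} := by
      simp only [Set.ofPred_forall]
      exact isClosed_iInter fun α => isClosed_le (by fun_prop) continuous_const
    refine residual_of_dense_open hclosed.isOpen_compl (interior_eq_empty_iff_dense_compl.1 ?_)
    by_contra! hinterior
    exact hne_top <| Submodule.eq_top_of_nonempty_interior' _ <|
      hinterior.mono (interior_mono fun x hx => ⟨m, hx⟩)
  filter_upwards [eventually_countable_forall.2 hresidual] with x hx
  rintro ⟨M, hM⟩
  obtain ⟨m, hm⟩ := exists_nat_ge M
  exact hx m fun α => (hM α).trans hm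

theorem exists_uniform_norm_bound {κ ν : Type*} [Countable κ] {ι : κ → ν → Type*}
    (T : ∀ k N, ι k N → E →SL[σ] F) (h : ∀ x, ∃ k, ∀ N, ∃ M : ℝ, ∀ α, ‖T k N α x‖ ≤ M) :
    ∃ k, ∀ N, ∃ M : ℝ, ∀ α, ‖T k N α‖ ≤ M := by
  by_contra! hunbounded
  choose N hN using hunbounded
  obtain ⟨x, hx⟩ := (dense_of_mem_residual <| eventually_countable_forall.2 fun k =>
    eventually_residual_notMem_boundedVectors (hN k)).nonempty
  obtain ⟨k, hk⟩ := h x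
  exact hx k (hk (N k))

end UniformBoundedness

section WeakUniformBoundedness

variable {𝕜 E F : Type*} [RCLike 𝕜] [SeminormedAddCommGroup E] [NormedSpace 𝕜 E]
  [CompleteSpace E] [NormedAddCommGroup F] [InnerProductSpace 𝕜 F] [CompleteSpace F]

theorem exists_uniform_norm_bound_of_inner {κ ν : Type*} [Countable κ] {ι : κ → ν → Type*}
    (T : ∀ k N, ι k N → E →L[𝕜] F)
    (h : ∀ x y, ∃ k, ∀ N, ∃ M : ℝ, ∀ α, ‖inner 𝕜 y (T k N α x)‖ ≤ M) :
    ∃ k, ∀ N, ∃ M : ℝ, ∀ α, ‖T k N α‖ ≤ M := by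
  refine exists_uniform_norm_bound T fun x => ?_
  have hdual := exists_uniform_norm_bound (fun k N α => innerSL 𝕜 (T k N α x)) fun y => by
    simpa only [innerSL_apply_apply, norm_inner_symm] using h x y
  simpa only [innerSL_apply_norm] using hdual

end WeakUniformBoundedness

section StrongIntegral

variable {𝕜 E F W : Type*} [NontriviallyNormedField 𝕜] [NormedAddCommGroup E] [NormedSpace 𝕜 E]
  [NormedAddCommGroup F] [NormedSpace 𝕜 F] [MeasurableSpace W] {μ : Measure W}
  {Q : W → E →L[𝕜] F}

/-- The linear map `u ↦ (y ↦ Q y u)` into `L¹`, for a strongly integrable family of operators. -/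
def orbitL1 (hQ : ∀ u, Integrable (fun y => Q y u) μ) : E →ₗ[𝕜] Lp F 1 μ where
  toFun u := (hQ u).toL1
  map_add' u v := by
    rw [← Integrable.toL1_add]
    simp only [map_add]
    rfl
  map_smul' c u := by
    simp only [map_smul, RingHom.id_apply]
    rfl

theorem orbitL1_apply (hQ : ∀ u, Integrable (fun y => Q y u) μ) (u : E) :
    orbitL1 hQ u = (hQ u).toL1 :=
  rfl

variable [CompleteSpace E] [CompleteSpace F]

theorem continuous_orbitL1 (hQ : ∀ u, Integrable (fun y => Q y u) μ) :
    Continuous (orbitL1 hQ) := by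
  refine LinearMap.continuous_of_seq_closed_graph _ fun u x g hu hg => ?_
  obtain ⟨ns, hns, hae⟩ := (tendstoInMeasure_of_tendsto_Lp hg).exists_seq_tendsto_ae
  have hcoe : ∀ᵐ y ∂μ, ∀ i, orbitL1 hQ (u (ns i)) y = Q y (u (ns i)) :=
    ae_all_iff.2 fun i => (hQ _).coeFn_toL1
  refine Lp.ext ?_
  filter_upwards [hae, hcoe, (hQ x).coeFn_toL1] with y hlim hcoe hx
  rw [orbitL1_apply, hx]
  refine tendsto_nhds_unique hlim (Tendsto.congr (fun i => (hcoe i).symm) ?_)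
  exact ((Q y).continuous.tendsto x).comp (hu.comp hns.tendsto_atTop)

theorem exists_integral_norm_apply_le (hQ : ∀ u, Integrable (fun y => Q y u) μ) :
    ∃ C : ℝ, ∀ u, ∫ y, ‖Q y u‖ ∂μ ≤ C * ‖u‖ := by
  let J : E →L[𝕜] Lp F 1 μ := ⟨orbitL1 hQ, continuous_orbitL1 hQ⟩
  refine ⟨‖J‖, fun u => ?_⟩
  calc ∫ y, ‖Q y u‖ ∂μ = ‖(hQ u).toL1‖ := (L1.norm_of_fun_eq_integral_norm (hQ u)).symm
    _ ≤ ‖J‖ * ‖u‖ := J.le_opNorm u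

variable [NormedSpace ℝ F] [SMulCommClass ℝ 𝕜 F]

/-- The operator `∫ Q y dμ(y)`, with the integral taken in the strong operator topology. -/
noncomputable def strongIntegral (hQ : ∀ u, Integrable (fun y => Q y u) μ) : E →L[𝕜] F :=
  LinearMap.mkContinuousOfExistsBound
    { toFun u := ∫ y, Q y u ∂μ
      map_add' u v := by simp only [map_add, integral_add (hQ u) (hQ v)]
      map_smul' c u := by simp only [map_smul, integral_smul, RingHom.id_apply] } <| by
    obtain ⟨C, hC⟩ := exists_integral_norm_apply_le hQ
    exact ⟨C, fun u => (norm_integral_le_integral_norm _).trans (hC u)⟩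

theorem strongIntegral_apply (hQ : ∀ u, Integrable (fun y => Q y u) μ) (u : E) :
    strongIntegral hQ u = ∫ y, Q y u ∂μ :=
  rfl

end StrongIntegral

section StrongIntegralInner

variable {𝕜 E F W : Type*} [RCLike 𝕜] [NormedAddCommGroup E] [NormedSpace 𝕜 E]
  [CompleteSpace E] [NormedAddCommGroup F] [InnerProductSpace 𝕜 F] [NormedSpace ℝ F]
  [CompleteSpace F] [MeasurableSpace W] {μ : Measure W} {Q : W → E →L[𝕜] F}

theorem inner_strongIntegral (hQ : ∀ u, Integrable (fun y => Q y u) μ) (v : F) (u : E) :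
    inner 𝕜 v (strongIntegral hQ u) = ∫ y, inner 𝕜 v (Q y u) ∂μ := by
  rw [strongIntegral_apply, integral_inner (hQ u)]

end StrongIntegralInner

section DouglasFactorization

variable {𝕜 E F G : Type*} [RCLike 𝕜] [NormedAddCommGroup E] [NormedSpace 𝕜 E]
  [NormedAddCommGroup F] [InnerProductSpace 𝕜 F] [CompleteSpace F]
  [NormedAddCommGroup G] [NormedSpace 𝕜 G] [CompleteSpace G]

theorem exists_eq_comp_of_norm_apply_le {T : E →L[𝕜] G} {S : E →L[𝕜] F} {C : ℝ}
    (h : ∀ x, ‖T x‖ ≤ C * ‖S x‖) : ∃ U : F →L[𝕜] G, T = U ∘L S := by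
  let R := S.range.topologicalClosure
  have : CompleteSpace R := S.range.isClosed_topologicalClosure.completeSpace_coe
  let S' : E →ₗ[𝕜] R :=
    (S : E →ₗ[𝕜] F).codRestrict R fun x => S.range.le_topologicalClosure ⟨x, rfl⟩
  have hdense : DenseRange S' := by
    rw [DenseRange, Subtype.dense_iff, ← Set.range_comp]
    exact subset_rfl
  refine ⟨(T : E →ₗ[𝕜] G).extendOfNorm S' ∘L R.orthogonalProjectionOnto,
    ContinuousLinearMap.ext fun x => ?_⟩
  calc T x = (T : E →ₗ[𝕜] G).extendOfNorm S' (S' x) :=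
        (LinearMap.extendOfNorm_eq hdense ⟨C, h⟩ x).symm
    _ = (T : E →ₗ[𝕜] G).extendOfNorm S' (R.orthogonalProjectionOnto (S x)) :=
        congrArg _ (Submodule.orthogonalProjectionOnto_mem_subspace_eq_self (S' x)).symm

end DouglasFactorization

section PositiveOperators

variable {V : Type*} [NormedAddCommGroup V] [InnerProductSpace ℂ V] [CompleteSpace V]

theorem norm_abs_apply (T : V →L[ℂ] V) (x : V) : ‖CFC.abs T x‖ = ‖T x‖ := by
  have hadjoint : (CFC.abs T).adjoint = CFC.abs T :=
    (IsSelfAdjoint.of_nonneg (CFC.abs_nonneg T)).star_eq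
  have habs : (CFC.abs T).adjoint ∘L CFC.abs T = T.adjoint ∘L T := by
    rw [hadjoint]
    exact CFC.abs_mul_abs T
  rw [← sq_eq_sq₀ (norm_nonneg _) (norm_nonneg _),
    ContinuousLinearMap.apply_norm_sq_eq_inner_adjoint_left, habs,
    ← ContinuousLinearMap.apply_norm_sq_eq_inner_adjoint_left]

theorem exists_eq_comp_abs (T : V →L[ℂ] V) : ∃ U : V →L[ℂ] V, T = U ∘L CFC.abs T :=
  exists_eq_comp_of_norm_apply_le (C := 1) fun x => by rw [one_mul, norm_abs_apply]

theorem adjoint_sqrt (P : V →L[ℂ] V) : (CFC.sqrt P).adjoint = CFC.sqrt P :=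
  (IsSelfAdjoint.of_nonneg (CFC.sqrt_nonneg P)).star_eq

theorem re_inner_apply_self_eq_norm_sqrt_sq {P : V →L[ℂ] V} (hP : 0 ≤ P) (x : V) :
    (inner ℂ x (P x)).re = ‖CFC.sqrt P x‖ ^ 2 := by
  have hsqrt : (CFC.sqrt P).adjoint ∘L CFC.sqrt P = P := by
    rw [adjoint_sqrt]
    exact CFC.sqrt_mul_sqrt_self P hP
  rw [ContinuousLinearMap.apply_norm_sq_eq_inner_adjoint_right, hsqrt]
  rfl

end PositiveOperators

section HilbertSchmidt

variable {𝕜 E F G ι κ : Type*} [RCLike 𝕜] [NormedAddCommGroup E] [InnerProductSpace 𝕜 E]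
  [NormedAddCommGroup F] [InnerProductSpace 𝕜 F] [NormedAddCommGroup G] [NormedSpace 𝕜 G]

theorem hasSum_norm_inner_sq (b : HilbertBasis ι 𝕜 E) (x : E) :
    HasSum (fun i => ‖inner 𝕜 (b i) x‖ ^ 2) (‖x‖ ^ 2) := by
  have hparseval := RCLike.hasSum_re 𝕜 (b.hasSum_inner_mul_inner x x)
  rw [inner_self_eq_norm_sq] at hparseval
  refine hparseval.congr_fun fun i => ?_
  rw [inner_mul_symm_re_eq_norm, norm_mul, norm_inner_symm x, sq]

theorem summable_mul_of_summable_sq {f g : ι → ℝ} (hf : Summable fun i => f i ^ 2)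
    (hg : Summable fun i => g i ^ 2) : Summable fun i => f i * g i := by
  refine .of_norm_bounded (hf.add hg) fun i => ?_
  rw [Real.norm_eq_abs, abs_le]
  constructor <;> nlinarith [sq_nonneg (f i + g i), sq_nonneg (f i - g i)]

theorem summable_norm_inner_sq (b : HilbertBasis ι 𝕜 E) (e : HilbertBasis κ 𝕜 F)
    {S : E →L[𝕜] F} (hS : Summable fun i => ‖S (b i)‖ ^ 2) :
    Summable fun p : ι × κ => ‖inner 𝕜 (e p.2) (S (b p.1))‖ ^ 2 := by
  rw [summable_prod_of_nonneg fun p => sq_nonneg _]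
  exact ⟨fun i => (hasSum_norm_inner_sq e (S (b i))).summable,
    hS.congr fun i => (hasSum_norm_inner_sq e (S (b i))).tsum_eq.symm⟩

theorem summable_norm_comp_sq {b : ι → E} {S : E →L[𝕜] F} (K : F →L[𝕜] G)
    (hS : Summable fun i => ‖S (b i)‖ ^ 2) : Summable fun i => ‖K (S (b i))‖ ^ 2 := by
  refine (hS.mul_left (‖K‖ ^ 2)).of_nonneg_of_le (fun i => sq_nonneg _) fun i => ?_
  rw [← mul_pow]
  exact pow_le_pow_left₀ (norm_nonneg _) (K.le_opNorm _) 2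

variable [CompleteSpace E] [CompleteSpace F]

theorem summable_norm_adjoint_sq (b : HilbertBasis ι 𝕜 E) (e : HilbertBasis κ 𝕜 F)
    {S : E →L[𝕜] F} (hS : Summable fun i => ‖S (b i)‖ ^ 2) :
    Summable fun j => ‖S.adjoint (e j)‖ ^ 2 := by
  refine (summable_norm_inner_sq b e hS).prod_symm.prod.congr fun j => ?_
  rw [← (hasSum_norm_inner_sq b (S.adjoint (e j))).tsum_eq]
  refine tsum_congr fun i => ?_
  rw [ContinuousLinearMap.adjoint_inner_right, norm_inner_symm]
  rfl

theorem hasSum_inner_adjoint_of_summable_sq (b : HilbertBasis ι 𝕜 E) (e : HilbertBasis κ 𝕜 F)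
    {A : E →L[𝕜] F} {B : F →L[𝕜] E} (hA : Summable fun i => ‖A (b i)‖ ^ 2)
    (hB : Summable fun j => ‖B (e j)‖ ^ 2) :
    HasSum (fun j => inner 𝕜 (A.adjoint (e j)) (B (e j))) (∑' i, inner 𝕜 (b i) (B (A (b i)))) := by
  let matrixProduct (p : ι × κ) : 𝕜 := inner 𝕜 (b p.1) (B (e p.2)) * inner 𝕜 (e p.2) (A (b p.1))
  have hsum : Summable matrixProduct := by
    refine .of_norm ?_
    simp only [matrixProduct, norm_mul]
    exact summable_mul_of_summable_sq (summable_norm_inner_sq e b hB).prod_symm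
      (summable_norm_inner_sq b e hA)
  have hrow (i : ι) : HasSum (fun j => matrixProduct (i, j)) (inner 𝕜 (b i) (B (A (b i)))) := by
    simpa only [ContinuousLinearMap.adjoint_inner_left] using
      e.hasSum_inner_mul_inner (B.adjoint (b i)) (A (b i))
  have hcolumn (j : κ) :
      HasSum (fun i => matrixProduct (i, j)) (inner 𝕜 (A.adjoint (e j)) (B (e j))) := by
    simpa only [matrixProduct, ContinuousLinearMap.adjoint_inner_left, mul_comm] using
      b.hasSum_inner_mul_inner (A.adjoint (e j)) (B (e j))
  rw [(hsum.hasSum.prod_fiberwise hrow).tsum_eq]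
  exact ((Equiv.prodComm κ ι).hasSum_iff.2 hsum.hasSum).prod_fiberwise hcolumn

end HilbertSchmidt

section TraceClassOperators

variable {V : Type*} [NormedAddCommGroup V] [InnerProductSpace ℂ V] [CompleteSpace V]

theorem trace_smul (c : ℂ) (K : V →L[ℂ] V) : trace (c • K) = c * trace K := by
  simp only [trace, smul_apply, inner_smul_right, tsum_mul_left]

-- If `T = U |T|` and `S = |T|^{1/2}`, then `Tr(K T) = Tr((K U S) S)` is the sum of the
-- `⟨S e, K U S e⟩` over the orthonormal basis, since `S` and `U S` are Hilbert-Schmidt.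
theorem IsTraceClass.exists_hasSum_trace_comp {T : V →L[ℂ] V} (hT : IsTraceClass T) :
    ∃ u v : basisIndex V → V, Summable (fun j => ‖u j‖ * ‖v j‖) ∧
      ∀ K : V →L[ℂ] V, HasSum (fun j => inner ℂ (v j) (K (u j))) (trace (K ∘L T)) := by
  obtain ⟨_, b, hb⟩ := hT
  obtain ⟨U, hU⟩ := exists_eq_comp_abs T
  let e := onBasis V
  let S := CFC.sqrt (CFC.abs T)
  have hSS : S ∘L S = CFC.abs T := CFC.sqrt_mul_sqrt_self _ (CFC.abs_nonneg T)
  have hS : Summable fun j => ‖S (e j)‖ ^ 2 := by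
    simp only [re_inner_apply_self_eq_norm_sqrt_sq (CFC.abs_nonneg T)] at hb
    simpa only [adjoint_sqrt] using summable_norm_adjoint_sq b e hb
  have hUS : Summable fun j => ‖U (S (e j))‖ ^ 2 := summable_norm_comp_sq U hS
  refine ⟨fun j => U (S (e j)), fun j => S (e j), summable_mul_of_summable_sq hUS hS,
    fun K => ?_⟩
  have htrace := hasSum_inner_adjoint_of_summable_sq e e (B := K ∘L U ∘L S) hS
    (summable_norm_comp_sq K hUS)
  have hKT : trace (K ∘L T) = ∑' i, inner ℂ (e i) ((K ∘L U ∘L S) (S (e i))) := by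
    conv_lhs => rw [hU, ← hSS]
    rfl
  rwa [adjoint_sqrt, ← hKT] at htrace

theorem IsTraceClass.exists_norm_trace_comp_le {T : V →L[ℂ] V} (hT : IsTraceClass T) :
    ∃ C : ℝ, ∀ K : V →L[ℂ] V, ‖trace (K ∘L T)‖ ≤ C * ‖K‖ := by
  obtain ⟨u, v, huv, htrace⟩ := hT.exists_hasSum_trace_comp
  refine ⟨∑' j, ‖u j‖ * ‖v j‖, fun K => ?_⟩
  rw [← (htrace K).tsum_eq, ← tsum_mul_right]
  refine tsum_of_norm_bounded (huv.mul_right ‖K‖).hasSum fun j => ?_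
  calc ‖inner ℂ (v j) (K (u j))‖ ≤ ‖v j‖ * (‖K‖ * ‖u j‖) :=
        (norm_inner_le_norm _ _).trans (by gcongr; exact K.le_opNorm _)
    _ = ‖u j‖ * ‖v j‖ * ‖K‖ := by ring

theorem IsTraceClass.exists_countable_hasSum_trace_comp {T : V →L[ℂ] V} (hT : IsTraceClass T) :
    ∃ (s : Set (basisIndex V)) (u v : s → V), s.Countable ∧
      Summable (fun j => ‖u j‖ * ‖v j‖) ∧
      ∀ K : V →L[ℂ] V, HasSum (fun j => inner ℂ (v j) (K (u j))) (trace (K ∘L T)) := by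
  obtain ⟨u, v, huv, htrace⟩ := hT.exists_hasSum_trace_comp
  refine ⟨Function.support fun j => ‖u j‖ * ‖v j‖, fun j => u j, fun j => v j,
    huv.countable_support, huv.subtype _, fun K => ?_⟩
  refine (hasSum_subtype_iff_of_support_subset fun j hj => ?_).2 (htrace K)
  contrapose! hj
  rw [Function.notMem_support, mul_eq_zero, norm_eq_zero, norm_eq_zero] at hj
  rw [Function.notMem_support]
  rcases hj with hj | hj <;> simp [hj]

theorem IsTraceClass.integral_trace_comp {W : Type*} [MeasurableSpace W] {μ : Measure W}
    {Q : W → V →L[ℂ] V} {T : V →L[ℂ] V} (hT : IsTraceClass T)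
    (hQ : ∀ u, Integrable (fun y => Q y u) μ) :
    ∫ y, trace (Q y ∘L T) ∂μ = trace (strongIntegral hQ ∘L T) := by
  obtain ⟨s, u, v, hs, huv, htrace⟩ := hT.exists_countable_hasSum_trace_comp
  obtain ⟨C, hC⟩ := exists_integral_norm_apply_le hQ
  have : Countable s := hs.to_subtype
  have hint (j : s) : Integrable (fun y => inner ℂ (v j) (Q y (u j))) μ := (hQ (u j)).const_inner _
  have hbound (j : s) : ∫ y, ‖inner ℂ (v j) (Q y (u j))‖ ∂μ ≤ ‖u j‖ * ‖v j‖ * C :=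
    calc ∫ y, ‖inner ℂ (v j) (Q y (u j))‖ ∂μ ≤ ∫ y, ‖v j‖ * ‖Q y (u j)‖ ∂μ :=
          integral_mono (hint j).norm ((hQ (u j)).norm.const_mul _) fun y => norm_inner_le_norm _ _
      _ = ‖v j‖ * ∫ y, ‖Q y (u j)‖ ∂μ := integral_const_mul _ _
      _ ≤ ‖v j‖ * (C * ‖u j‖) := by gcongr; exact hC _
      _ = ‖u j‖ * ‖v j‖ * C := by ring
  have hsum := hasSum_integral_of_summable_integral_norm hint <|
    (huv.mul_right C).of_nonneg_of_le (fun j => integral_nonneg fun y => norm_nonneg _) hbound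
  simp only [(htrace _).tsum_eq, ← inner_strongIntegral hQ] at hsum
  exact hsum.unique (htrace _)

end TraceClassOperators

section RankOne

variable {V : Type*} [NormedAddCommGroup V] [InnerProductSpace ℂ V] [CompleteSpace V]

open InnerProductSpace

-- For `v = 0` both sides vanish, whatever the value of `‖u‖ / 0`.
theorem abs_rankOne (u v : V) :
    CFC.abs (rankOne ℂ u v) = (‖u‖ / ‖v‖ : ℝ) • (rankOne ℂ v v : V →L[ℂ] V) := by
  rcases eq_or_ne v 0 with rfl | hv
  · simp
  have hv' : (‖v‖ : ℂ) ≠ 0 := by simpa using hv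
  have hpos : 0 ≤ (rankOne ℂ v v : V →L[ℂ] V) :=
    (ContinuousLinearMap.nonneg_iff_isPositive _).2 (isPositive_rankOne_self v)
  refine CFC.sqrt_unique ?_ (smul_nonneg (by positivity) hpos)
  rw [ContinuousLinearMap.star_eq_adjoint, adjoint_rankOne, smul_mul_smul_comm,
    ContinuousLinearMap.mul_def, ContinuousLinearMap.mul_def, rankOne_comp_rankOne,
    rankOne_comp_rankOne, ← Complex.coe_smul, smul_smul, inner_self_eq_norm_sq_to_K,
    inner_self_eq_norm_sq_to_K]
  congr 1
  push_cast
  field_simp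
  exact mul_comm _ _

theorem isTraceClass_rankOne (u v : V) : IsTraceClass (rankOne ℂ u v) := by
  refine ⟨_, onBasis V, ?_⟩
  refine ((hasSum_norm_inner_sq (onBasis V) v).summable.mul_left (‖u‖ / ‖v‖)).congr fun i => ?_
  have hdiag : (inner ℂ v (onBasis V i) * inner ℂ (onBasis V i) v : ℂ).re =
      ‖inner ℂ (onBasis V i) v‖ ^ 2 := by
    rw [← RCLike.re_eq_complex_re, inner_mul_symm_re_eq_norm, norm_mul, norm_inner_symm v, sq]
  rw [abs_rankOne, ← Complex.coe_smul, smul_apply, rankOne_apply,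
    inner_smul_right, inner_smul_right, Complex.re_ofReal_mul, hdiag]

theorem trace_comp_rankOne (K : V →L[ℂ] V) (u v : V) :
    trace (K ∘L rankOne ℂ u v) = inner ℂ v (K u) := by
  rw [← (onBasis V).tsum_inner_mul_inner]
  refine tsum_congr fun i => ?_
  rw [ContinuousLinearMap.comp_apply, rankOne_apply, map_smul, inner_smul_right]

end RankOne

section Cones

variable {E : Type*} [SeminormedAddCommGroup E] [NormedSpace ℝ E] {ξ : E} {r : ℝ}

/-- The open cone generated by the ball of radius `r` around `ξ`. -/
def openCone (ξ : E) (r : ℝ) : Set E := {η | ∃ t : ℝ, 0 < t ∧ t • η ∈ Metric.ball ξ r}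

theorem isOpen_openCone : IsOpen (openCone ξ r) := by
  have hunion : openCone ξ r = ⋃ (t : ℝ) (_ : 0 < t), (t • ·) ⁻¹' Metric.ball ξ r := by
    ext η
    simp [openCone]
  rw [hunion]
  exact isOpen_biUnion fun t _ => Metric.isOpen_ball.preimage (continuous_const_smul t)

theorem isCone_openCone : IsCone (openCone ξ r) := by
  rintro η ⟨t, ht, hη⟩ s hs
  refine ⟨t * s⁻¹, by positivity, ?_⟩
  rwa [smul_smul, inv_mul_cancel_right₀ hs.ne']

theorem mem_openCone_self (hr : 0 < r) : ξ ∈ openCone ξ r :=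
  ⟨1, one_pos, by simpa using hr⟩

theorem openCone_mono {s : ℝ} (hrs : r ≤ s) : openCone ξ r ⊆ openCone ξ s :=
  fun _ ⟨t, ht, hη⟩ => ⟨t, ht, Metric.ball_subset_ball hrs hη⟩

theorem IsCone.exists_openCone_sub_mem {C : Set E} (hcone : IsCone C) (hC : IsOpen C)
    (hξ : ξ ∈ C) :
    ∃ r > 0, ∃ δ > 0, ∀ η ∈ openCone ξ r, ∀ ζ : E, ‖ζ‖ ≤ δ * ‖η‖ → η - ζ ∈ C := by
  obtain ⟨R, hR, hball⟩ := Metric.isOpen_iff.1 hC ξ hξ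
  have : 0 < ‖ξ‖ + R := by positivity
  refine ⟨R / 2, by positivity, R / 2 / (‖ξ‖ + R), by positivity, ?_⟩
  rintro η ⟨t, ht, hη⟩ ζ hζ
  rw [mem_ball_iff_norm] at hη
  have htη : ‖t • η‖ ≤ ‖ξ‖ + R := by
    linarith [norm_sub_norm_le (t • η) ξ]
  have htζ : ‖t • ζ‖ ≤ R / 2 :=
    calc ‖t • ζ‖ = t * ‖ζ‖ := norm_smul_of_nonneg ht.le ζ
      _ ≤ t * (R / 2 / (‖ξ‖ + R) * ‖η‖) := by gcongr
      _ = R / 2 / (‖ξ‖ + R) * ‖t • η‖ := by rw [norm_smul_of_nonneg ht.le]; ring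
      _ ≤ R / 2 / (‖ξ‖ + R) * (‖ξ‖ + R) := by gcongr
      _ = R / 2 := by field_simp
  have hmem : t • (η - ζ) ∈ C := by
    refine hball (mem_ball_iff_norm.2 ?_)
    calc ‖t • (η - ζ) - ξ‖ = ‖(t • η - ξ) - t • ζ‖ := by rw [smul_sub, sub_right_comm]
      _ ≤ ‖t • η - ξ‖ + ‖t • ζ‖ := norm_sub_le _ _
      _ < R := by linarith
  simpa only [inv_smul_smul₀ ht.ne'] using hcone _ hmem t⁻¹ (inv_pos.2 ht)

end Cones

theorem exists_norm_pow_mul_norm_sub_le {E F : Type*} [SeminormedAddCommGroup E]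
    [SeminormedAddCommGroup F] {G : E → F} {C Γ : Set E} {A B δ : ℝ} {N : ℕ} (hδ : 0 < δ)
    (hΓ : ∀ η ∈ Γ, ∀ ζ, ‖ζ‖ ≤ δ * ‖η‖ → η - ζ ∈ C) (hB : ∀ η, ‖G η‖ ≤ B)
    (hA : ∀ η ∈ C, ‖η‖ ^ N * ‖G η‖ ≤ A) :
    ∃ K : ℝ, ∀ η ∈ Γ, ∀ ζ, ‖η‖ ^ N * ‖G (η - ζ)‖ ≤ K * (1 + ‖ζ‖ ^ N) := by
  have hB₀ : 0 ≤ B := (norm_nonneg _).trans (hB 0)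
  refine ⟨2 ^ (N - 1) * (|A| + B) + B / δ ^ N, fun η hη ζ => ?_⟩
  rcases le_total ‖ζ‖ (δ * ‖η‖) with hζ | hζ
  · have htriangle : ‖η‖ ≤ ‖η - ζ‖ + ‖ζ‖ := by simpa using norm_add_le (η - ζ) ζ
    calc ‖η‖ ^ N * ‖G (η - ζ)‖
        ≤ 2 ^ (N - 1) * (‖η - ζ‖ ^ N + ‖ζ‖ ^ N) * ‖G (η - ζ)‖ := by
          gcongr
          exact (pow_le_pow_left₀ (norm_nonneg _) htriangle N).trans <|
            add_pow_le (norm_nonneg _) (norm_nonneg _) N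
      _ = 2 ^ (N - 1) * (‖η - ζ‖ ^ N * ‖G (η - ζ)‖ + ‖ζ‖ ^ N * ‖G (η - ζ)‖) := by ring
      _ ≤ 2 ^ (N - 1) * (|A| + ‖ζ‖ ^ N * B) := by
          gcongr
          · exact (hA _ (hΓ η hη ζ hζ)).trans (le_abs_self A)
          · exact hB _
      _ ≤ 2 ^ (N - 1) * ((|A| + B) * (1 + ‖ζ‖ ^ N)) := by
          gcongr
          nlinarith [mul_nonneg (abs_nonneg A) (pow_nonneg (norm_nonneg ζ) N)]
      _ ≤ 2 ^ (N - 1) * ((|A| + B) * (1 + ‖ζ‖ ^ N)) + B / δ ^ N * (1 + ‖ζ‖ ^ N) :=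
          le_add_of_nonneg_right (by positivity)
      _ = (2 ^ (N - 1) * (|A| + B) + B / δ ^ N) * (1 + ‖ζ‖ ^ N) := by ring
  · calc ‖η‖ ^ N * ‖G (η - ζ)‖ ≤ (‖ζ‖ / δ) ^ N * B := by
          gcongr
          · rwa [le_div_iff₀' hδ]
          · exact hB _
      _ = B / δ ^ N * ‖ζ‖ ^ N := by rw [div_pow]; ring
      _ ≤ B / δ ^ N * (1 + ‖ζ‖ ^ N) := by gcongr; linarith
      _ ≤ (2 ^ (N - 1) * (|A| + B) + B / δ ^ N) * (1 + ‖ζ‖ ^ N) := by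
          gcongr
          exact le_add_of_nonneg_left (by positivity)

section MulI

variable (W : Type*) [AddCommGroup W] [Module ℝ W] [TopologicalSpace W]

/-- Multiplication by `i` as a linear homeomorphism from `W*` onto `iW*`. -/
noncomputable def mulIEquiv : (W →L[ℝ] ℝ) ≃L[ℝ] ImagDual W where
  toFun := mulI
  invFun ξ := Complex.imCLM ∘L (ξ : W →L[ℝ] ℂ)
  map_add' a b := by
    ext w
    simp [mulI]
  map_smul' c a := by
    ext w
    simp [mulI, mul_left_comm]
  left_inv a := by
    ext w
    simp [mulI]
  right_inv ξ := by
    ext w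
    apply Complex.ext
    · simpa [mulI] using (ξ.2 w).symm
    · simp [mulI]
  continuous_toFun := Continuous.subtype_mk
    ((Complex.I • Complex.ofRealCLM : ℝ →L[ℝ] ℂ).postcomp W).continuous _
  continuous_invFun := (Complex.imCLM.postcomp W).continuous.comp continuous_subtype_val

theorem coe_mulIEquiv : ⇑(mulIEquiv W) = mulI := rfl

end MulI

section Fourier

theorem norm_mulI {W : Type*} [SeminormedAddCommGroup W] [NormedSpace ℝ W] (η : W →L[ℝ] ℝ) :
    ‖mulI η‖ = ‖η‖ := by
  have hsmul : (mulI η : W →L[ℝ] ℂ) = Complex.I • (Complex.ofRealCLM ∘L η) := rfl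
  rw [Submodule.coe_norm, hsmul, norm_smul, Complex.norm_I, one_mul]
  exact Complex.ofRealLI.norm_toContinuousLinearMap_comp

variable {W : Type*} [NormedAddCommGroup W] [InnerProductSpace ℝ W]

/-- The imaginary covector `y ↦ -2πi⟨w, y⟩`, the exponent of the character `e^{-2πi⟨w, y⟩}` with
which Mathlib's Fourier transform is defined. -/
noncomputable def freq (w : W) : ImagDual W := mulI (-(2 * Real.pi) • innerSL ℝ w)

theorem freq_apply (w y : W) :
    (freq w : W →L[ℝ] ℂ) y = -(2 * Real.pi * inner ℝ w y * Complex.I) := by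
  simp [freq, mulI]
  ring

theorem norm_freq (w : W) : ‖freq w‖ = 2 * Real.pi * ‖w‖ := by
  rw [freq, norm_mulI, norm_smul, innerSL_apply_norm, norm_neg,
    Real.norm_of_nonneg Real.two_pi_pos.le]

theorem norm_exp_neg_imagDual (ξ : ImagDual W) (y : W) :
    ‖Complex.exp (-((ξ : W →L[ℝ] ℂ) y))‖ = 1 := by
  rw [Complex.norm_exp, Complex.neg_re, ξ.2 y, neg_zero, Real.exp_zero]

theorem fourierChar_smul_exp_smul (g : W → ℂ) (ξ : ImagDual W) (w y : W) :
    Real.fourierChar (-inner ℝ w y) • Complex.exp (-((ξ : W →L[ℝ] ℂ) y)) • g y =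
      g y * Complex.exp (-(((ξ - freq w : ImagDual W) : W →L[ℝ] ℂ) y)) := by
  simp only [Circle.smul_def, Real.fourierChar_apply, Submodule.coe_sub, sub_apply, freq_apply,
    smul_eq_mul]
  rw [← mul_assoc, ← Complex.exp_add, mul_comm]
  congr 2
  push_cast
  ring

theorem rapidlyDecaying_iff {F : ImagDual W → ℂ} {C : Set (ImagDual W)} :
    RapidlyDecaying F C ↔ ∀ N : ℕ, ∃ A : ℝ, ∀ ξ ∈ C, ‖ξ‖ ^ N * ‖F ξ‖ ≤ A :=
  ⟨fun h N => (h N).imp fun _ => And.right, fun h N =>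
    let ⟨A, hA⟩ := h N
    ⟨max A 1, by positivity, fun ξ hξ => (hA ξ hξ).trans (le_max_left A 1)⟩⟩

variable [MeasurableSpace W] [BorelSpace W] [FiniteDimensional ℝ W]

theorem norm_imagFourier_le (g : W → ℂ) (ξ : ImagDual W) :
    ‖imagFourier g ξ‖ ≤ ((2 * Real.pi) ^ Module.finrank ℝ W)⁻¹ * ∫ y, ‖g y‖ := by
  rw [imagFourier, norm_mul, Complex.norm_real, Real.norm_of_nonneg (by positivity)]
  gcongr
  refine (norm_integral_le_integral_norm _).trans_eq ?_
  simp only [norm_mul, norm_exp_neg_imagDual, mul_one]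

theorem integrable_exp_neg_imagDual_smul {F : Type*} [NormedAddCommGroup F] [NormedSpace ℂ F]
    {g : W → F} (hg : Integrable g) (ξ : ImagDual W) :
    Integrable fun y => Complex.exp (-((ξ : W →L[ℝ] ℂ) y)) • g y :=
  hg.bdd_smul 1 (Continuous.aestronglyMeasurable (by fun_prop))
    (.of_forall fun y => (norm_exp_neg_imagDual ξ y).le)

open FourierTransform in
theorem imagFourier_fourier_mul {Φ g : W → ℂ} (hΦ : Integrable Φ) (hg : Integrable g)
    (ξ : ImagDual W) :
    imagFourier (fun y => 𝓕 Φ y * g y) ξ = ∫ w, Φ w * imagFourier g (ξ - freq w) := by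
  have hflip := VectorFourier.integral_fourierIntegral_smul_eq_flip (μ := volume) (ν := volume)
    (L := innerₗ W) Real.continuous_fourierChar continuous_inner hΦ
    (integrable_exp_neg_imagDual_smul hg ξ)
  have hshift : ∀ w, VectorFourier.fourierIntegral Real.fourierChar volume (innerₗ W).flip
      (fun y => Complex.exp (-((ξ : W →L[ℝ] ℂ) y)) • g y) w =
        ∫ y, g y * Complex.exp (-(((ξ - freq w : ImagDual W) : W →L[ℝ] ℂ) y)) := fun w =>
    integral_congr_ae (.of_forall (fourierChar_smul_exp_smul g ξ w))
  simp only [hshift] at hflip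
  simp only [smul_eq_mul, mul_comm _ (g _)] at hflip
  simp only [imagFourier, mul_left_comm (Φ _), integral_const_mul, mul_assoc]
  rw [← hflip]
  rfl

theorem RapidlyDecaying.imagFourier_schwartz_mul {g : W → ℂ} {C Γ : Set (ImagDual W)} {δ : ℝ}
    (hdecay : RapidlyDecaying (imagFourier g) C) (hg : Integrable g) (hδ : 0 < δ)
    (hΓ : ∀ η ∈ Γ, ∀ ζ, ‖ζ‖ ≤ δ * ‖η‖ → η - ζ ∈ C) (Ψ : SchwartzMap W ℂ) :
    RapidlyDecaying (imagFourier fun y => Ψ y * g y) Γ := by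
  refine rapidlyDecaying_iff.2 fun N => ?_
  obtain ⟨A, -, hA⟩ := hdecay N
  obtain ⟨K, hK⟩ := exists_norm_pow_mul_norm_sub_le hδ hΓ (norm_imagFourier_le g) hA
  let Φ : SchwartzMap W ℂ := FourierTransform.fourierInv Ψ
  have hΨ : ⇑Ψ = FourierTransform.fourier ⇑Φ := by
    rw [← SchwartzMap.fourier_coe, FourierTransform.fourier_fourierInv_eq]
  have hbound : Integrable fun w => ‖Φ w‖ * (K * (1 + ‖freq w‖ ^ N)) := by
    refine ((Φ.integrable.norm.const_mul K).add
      ((Φ.integrable_pow_mul volume N).const_mul (K * (2 * Real.pi) ^ N))).congr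
      (.of_forall fun w => ?_)
    simp only [Pi.add_apply, norm_freq, mul_pow]
    ring
  refine ⟨∫ w, ‖Φ w‖ * (K * (1 + ‖freq w‖ ^ N)), fun η hη => ?_⟩
  rw [hΨ, imagFourier_fourier_mul Φ.integrable hg]
  calc ‖η‖ ^ N * ‖∫ w, Φ w * imagFourier g (η - freq w)‖
      ≤ ‖η‖ ^ N * ∫ w, ‖Φ w * imagFourier g (η - freq w)‖ := by
        gcongr
        exact norm_integral_le_integral_norm _
    _ = ∫ w, ‖Φ w‖ * (‖η‖ ^ N * ‖imagFourier g (η - freq w)‖) := by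
        simp only [← integral_const_mul, norm_mul, mul_left_comm]
    _ ≤ ∫ w, ‖Φ w‖ * (K * (1 + ‖freq w‖ ^ N)) := by
        refine integral_mono_of_nonneg (.of_forall fun w => by positivity) hbound
          (.of_forall fun w => ?_)
        exact mul_le_mul_of_nonneg_left (hK η hη _) (norm_nonneg _)

end Fourier

section Cutoff

variable {W : Type*} [NormedAddCommGroup W] [InnerProductSpace ℝ W] {X : Set W}

theorem IsTestFunction.div {χ φ : W → ℂ} (hχ : IsTestFunction X χ) (hφ : ContDiff ℝ ∞ φ)
    (hne : ∀ y ∈ tsupport χ, φ y ≠ 0) : IsTestFunction X fun y => χ y / φ y := by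
  simp only [div_eq_mul_inv]
  refine ⟨contDiff_iff_contDiffAt.2 fun y => ?_, hχ.2.1.mul_right,
    (tsupport_mul_subset_left (f := χ)).trans hχ.2.2⟩
  by_cases hy : y ∈ tsupport χ
  · exact hχ.1.contDiffAt.mul (hφ.contDiffAt.inv (hne y hy))
  · refine (contDiffAt_const (c := (0 : ℂ))).congr_of_eventuallyEq ?_
    filter_upwards [notMem_tsupport_iff_eventuallyEq.1 hy] with z hz
    simp [hz]

theorem IsTestFunction.mul_left {ψ φ : W → ℂ} (hφ : IsTestFunction X φ) (hψ : ContDiff ℝ ∞ ψ) :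
    IsTestFunction X fun y => ψ y * φ y :=
  ⟨hψ.mul hφ.1, hφ.2.1.mul_left, (tsupport_mul_subset_right (f := ψ)).trans hφ.2.2⟩

theorem contDiff_gauss (t : ℝ) (x : W) : ContDiff ℝ ∞ fun y => (gauss t ‖x - y‖ : ℂ) :=
  Complex.ofRealCLM.contDiff.comp
    (contDiff_const.mul ((contDiff_const.sub contDiff_id).norm_sq ℝ)).neg.exp

theorem IsTestFunction.continuous_smul {F : Type*} [SeminormedAddCommGroup F] [NormedSpace ℂ F]
    {χ : W → ℂ} {f : W → F} (hχ : IsTestFunction X χ) (hX : IsOpen X) (hf : ContinuousOn f X) :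
    Continuous fun y => χ y • f y :=
  (hχ.1.continuous.continuousOn.smul hf).continuous_of_tsupport_subset hX
    ((tsupport_smul_subset_left χ f).trans hχ.2.2)

theorem exists_seq_isTestFunction [FiniteDimensional ℝ W] (hX : IsOpen X) {x : W} (hx : x ∈ X) :
    ∃ χ : ℕ → W → ℂ, (∀ k, IsTestFunction X (χ k)) ∧ (∀ k, χ k x ≠ 0) ∧
      ∀ U ∈ 𝓝 x, ∃ k, tsupport (χ k) ⊆ U := by
  obtain ⟨b, hb⟩ := (𝓝 x).exists_antitone_basis
  have hexists : ∀ k, ∃ χ : W → ℂ, IsTestFunction X χ ∧ χ x ≠ 0 ∧ tsupport χ ⊆ b k := by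
    intro k
    obtain ⟨f, hsupp, hcompact, hsmooth, -, hone⟩ :=
      exists_contDiff_tsupport_subset (n := ⊤) (inter_mem (hX.mem_nhds hx) (hb.mem k))
    have htsupp : tsupport (fun y => (f y : ℂ)) ⊆ tsupport f :=
      closure_mono fun y hy => by simpa using hy
    refine ⟨fun y => f y, ⟨Complex.ofRealCLM.contDiff.comp hsmooth,
      hcompact.comp_left Complex.ofReal_zero, fun y hy => (hsupp (htsupp hy)).1⟩, by simp [hone],
      fun y hy => (hsupp (htsupp hy)).2⟩
  choose χ hχ hne hsupp using hexists
  refine ⟨χ, hχ, hne, fun U hU => ?_⟩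
  obtain ⟨k, -, hk⟩ := hb.1.mem_iff.1 hU
  exact ⟨k, (hsupp k).trans hk⟩

variable [FiniteDimensional ℝ W] [MeasurableSpace W] [BorelSpace W]

theorem IsTestFunction.integrable_smul {F : Type*} [NormedAddCommGroup F] [NormedSpace ℂ F]
    {χ : W → ℂ} {f : W → F} (hχ : IsTestFunction X χ) (hX : IsOpen X) (hf : ContinuousOn f X) :
    Integrable fun y => χ y • f y :=
  (hχ.continuous_smul hX hf).integrable_of_hasCompactSupport hχ.2.1.smul_right

theorem exists_rapidlyDecaying_of_notMem_wavefrontFiber (hX : IsOpen X) {f : W → ℂ}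
    (hf : ContinuousOn f X) {x : W} {ξ : ImagDual W} (hξ : ξ ∉ wavefrontFiber X f x) :
    ∃ U ∈ 𝓝 x, ∃ m : ℕ, ∀ χ : W → ℂ, IsTestFunction X χ → tsupport χ ⊆ U →
      RapidlyDecaying (imagFourier fun y => χ y * f y) (openCone ξ (1 / (m + 1))) := by
  obtain ⟨-, C, hC, hcone, hξC, φ, hφ, hφx, hdecay⟩ : ξ ≠ 0 ∧ _ := by
    simpa only [wavefrontFiber, Set.mem_ofPred_eq, not_or, not_not] using hξ
  obtain ⟨r, hr, δ, hδ, hsub⟩ := IsCone.exists_openCone_sub_mem (by exact hcone) hC hξC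
  obtain ⟨m, hm⟩ := exists_nat_one_div_lt hr
  refine ⟨{y | φ y ≠ 0}, hφ.1.continuous.continuousAt.eventually_ne hφx, m,
    fun χ hχ hsupp => ?_⟩
  have hdiv := hχ.div hφ.1 hsupp
  have hcancel : (fun y => χ y * f y) = fun y => χ y / φ y * (φ y * f y) := by
    ext y
    by_cases hy : φ y = 0
    · have hχy : χ y = 0 := image_eq_zero_of_notMem_tsupport fun h => hsupp h hy
      simp [hχy]
    · field_simp
  rw [hcancel]
  exact hdecay.imagFourier_schwartz_mul (hφ.integrable_smul hX hf) hδ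
    (fun η hη => hsub η (openCone_mono hm.le hη)) (hdiv.2.1.toSchwartzMap hdiv.1)

end Cutoff

section OperatorFourier

variable {W : Type*} [NormedAddCommGroup W] [InnerProductSpace ℝ W] [FiniteDimensional ℝ W]
  [MeasurableSpace W] [BorelSpace W] {V : Type*} [NormedAddCommGroup V] [InnerProductSpace ℂ V]
  [CompleteSpace V]

/-- The operator-valued analogue of `imagFourier`: the Fourier transform of a strongly integrable
family of operators, with the integral taken in the strong operator topology. -/
noncomputable def operatorFourier {Q : W → V →L[ℂ] V} (hQ : ∀ u, Integrable fun y => Q y u)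
    (ξ : ImagDual W) : V →L[ℂ] V :=
  ((((2 * Real.pi) ^ Module.finrank ℝ W)⁻¹ : ℝ) : ℂ) •
    strongIntegral (Q := fun y => Complex.exp (-((ξ : W →L[ℝ] ℂ) y)) • Q y)
      fun u => integrable_exp_neg_imagDual_smul (hQ u) ξ

theorem inner_operatorFourier {Q : W → V →L[ℂ] V} (hQ : ∀ u, Integrable fun y => Q y u)
    (ξ : ImagDual W) (u v : V) :
    inner ℂ v (operatorFourier hQ ξ u) = imagFourier (fun y => inner ℂ v (Q y u)) ξ := by
  rw [operatorFourier, smul_apply, inner_smul_right, inner_strongIntegral, imagFourier]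
  simp only [smul_apply, inner_smul_right, mul_comm]

theorem trace_operatorFourier_comp {Q : W → V →L[ℂ] V} (hQ : ∀ u, Integrable fun y => Q y u)
    (ξ : ImagDual W) {T : V →L[ℂ] V} (hT : IsTraceClass T) :
    trace (operatorFourier hQ ξ ∘L T) = imagFourier (fun y => trace (Q y ∘L T)) ξ := by
  rw [operatorFourier, ContinuousLinearMap.smul_comp, trace_smul, ← hT.integral_trace_comp,
    imagFourier]
  simp only [ContinuousLinearMap.smul_comp, trace_smul, mul_comm]

theorem exists_norm_imagFourier_trace_comp_le {κ ν : Type*} [Countable κ] {ι : κ → ν → Type*}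
    {Q : ∀ k N, ι k N → W → V →L[ℂ] V} (hQ : ∀ k N α u, Integrable fun y => Q k N α y u)
    {ξ : ∀ k N, ι k N → ImagDual W} {r : ∀ k N, ι k N → ℝ} (hr : ∀ k N α, 0 ≤ r k N α)
    (h : ∀ u v, ∃ k, ∀ N, ∃ M : ℝ, ∀ α,
      r k N α * ‖imagFourier (fun y => inner ℂ v (Q k N α y u)) (ξ k N α)‖ ≤ M)
    {T : V →L[ℂ] V} (hT : IsTraceClass T) :
    ∃ k, ∀ N, ∃ M : ℝ, ∀ α,
      r k N α * ‖imagFourier (fun y => trace (Q k N α y ∘L T)) (ξ k N α)‖ ≤ M := by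
  have hnorm (k N α) (z : ℂ) : ‖(r k N α : ℂ) * z‖ = r k N α * ‖z‖ := by
    rw [norm_mul, Complex.norm_of_nonneg (hr k N α)]
  obtain ⟨k, hk⟩ := exists_uniform_norm_bound_of_inner
    (fun k N α => (r k N α : ℂ) • operatorFourier (hQ k N α) (ξ k N α)) fun u v => by
      simpa only [smul_apply, inner_smul_right, inner_operatorFourier, hnorm] using h u v
  obtain ⟨C, hC⟩ := hT.exists_norm_trace_comp_le
  refine ⟨k, fun N => ?_⟩
  obtain ⟨M, hM⟩ := hk N
  refine ⟨|C| * M, fun α => ?_⟩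
  rw [← trace_operatorFourier_comp (hQ k N α) (ξ k N α) hT, ← hnorm, ← trace_smul,
    ← ContinuousLinearMap.smul_comp]
  calc _ ≤ C * ‖(r k N α : ℂ) • operatorFourier (hQ k N α) (ξ k N α)‖ := hC _
    _ ≤ |C| * M := by
      gcongr
      · exact le_abs_self C
      · exact hM α

end OperatorFourier

section TraceFibers

theorem exists_exp_decay_iff {E : Type*} [PseudoMetricSpace E] {F : ℝ → E → ℝ} {ξ : E} :
    (∃ Ω : Set E, IsOpen Ω ∧ ξ ∈ Ω ∧ ∃ ε : ℝ, 0 < ε ∧ ∃ A : ℝ, 0 < A ∧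
      ∀ t : ℝ, 0 < t → ∀ η ∈ Ω, F t η ≤ A * Real.exp (-(ε * t))) ↔
    ∃ k : ℕ, ∃ M : ℝ, ∀ p : Set.Ioi (0 : ℝ) × Metric.ball ξ (1 / (k + 1)),
      Real.exp (1 / (k + 1) * p.1) * F p.1 p.2 ≤ M := by
  constructor
  · rintro ⟨Ω, hΩ, hξ, ε, hε, A, hA, hdecay⟩
    obtain ⟨R, hR, hball⟩ := Metric.isOpen_iff.1 hΩ ξ hξ
    obtain ⟨k, hk⟩ := exists_nat_one_div_lt (lt_min hR hε)
    obtain ⟨hkR, hkε⟩ := lt_min_iff.1 hk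
    refine ⟨k, A, fun ⟨⟨t, ht⟩, η, hη⟩ => ?_⟩
    rw [Set.mem_Ioi] at ht
    calc Real.exp (1 / (k + 1) * t) * F t η
        ≤ Real.exp (1 / (k + 1) * t) * (A * Real.exp (-(ε * t))) := by
          gcongr
          exact hdecay t ht η (hball (Metric.ball_subset_ball hkR.le hη))
      _ ≤ Real.exp (ε * t) * (A * Real.exp (-(ε * t))) := by gcongr
      _ = A := by rw [mul_left_comm, ← Real.exp_add, add_neg_cancel, Real.exp_zero, mul_one]
  · rintro ⟨k, M, hM⟩
    refine ⟨Metric.ball ξ (1 / (k + 1)), Metric.isOpen_ball, Metric.mem_ball_self (by positivity),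
      1 / (k + 1), by positivity, max M 1, by positivity, fun t ht η hη => ?_⟩
    rw [Real.exp_neg, ← div_eq_mul_inv, le_div_iff₀' (Real.exp_pos _)]
    exact (hM ⟨⟨t, ht⟩, ⟨η, hη⟩⟩).trans (le_max_left M 1)

variable {W : Type*} [NormedAddCommGroup W] [InnerProductSpace ℝ W] [FiniteDimensional ℝ W]
  [MeasurableSpace W] [BorelSpace W] {V : Type*} [NormedAddCommGroup V] [InnerProductSpace ℂ V]
  [CompleteSpace V] {X : Set W} {P : W → V →L[ℂ] V} {T : V →L[ℂ] V}

theorem wavefrontFiber_trace_comp_subset (hX : IsOpen X)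
    (hP : ∀ u, ContinuousOn (fun y => P y u) X) {x : W} (hx : x ∈ X) (hT : IsTraceClass T) :
    wavefrontFiber X (fun y => trace (P y ∘L T)) x ⊆
      ⋃ (u : V) (v : V), wavefrontFiber X (fun y => inner ℂ v (P y u)) x := by
  intro ξ hξ
  by_contra! hnotMem
  simp only [Set.mem_iUnion, not_exists] at hnotMem
  obtain ⟨χ, hχ, hχx, hshrink⟩ := exists_seq_isTestFunction hX hx
  have hcoeff : ∀ u v, ∃ κ : ℕ × ℕ, ∀ N : ℕ, ∃ A : ℝ, ∀ η : openCone ξ (1 / (κ.2 + 1)),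
      ‖(η : ImagDual W)‖ ^ N *
        ‖imagFourier (fun y => inner ℂ v ((χ κ.1 y • P y) u)) η‖ ≤ A := by
    intro u v
    obtain ⟨U, hU, m, hdecay⟩ := exists_rapidlyDecaying_of_notMem_wavefrontFiber hX
      (continuousOn_const.inner (𝕜 := ℂ) (hP u)) (hnotMem u v)
    obtain ⟨k, hk⟩ := hshrink U hU
    refine ⟨(k, m), fun N => (rapidlyDecaying_iff.1 (hdecay (χ k) (hχ k) hk) N).imp ?_⟩
    intro A hA η
    simpa only [smul_apply, inner_smul_right] using hA η η.2
  obtain ⟨⟨k, m⟩, hdecay⟩ := exists_norm_imagFourier_trace_comp_le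
    (fun κ _ _ u => (hχ κ.1).integrable_smul hX (hP u)) (fun _ _ _ => by positivity) hcoeff hT
  rcases hξ with rfl | hξ
  · exact hnotMem 0 0 (Or.inl rfl)
  · refine hξ ⟨openCone ξ (1 / (m + 1)), isOpen_openCone, isCone_openCone,
      mem_openCone_self (by positivity), χ k, hχ k, hχx k,
      rapidlyDecaying_iff.2 fun N => (hdecay N).imp fun A hA η hη => ?_⟩
    simpa only [ContinuousLinearMap.smul_comp, trace_smul] using hA ⟨η, hη⟩

theorem singularFiber_trace_comp_subset (hX : IsOpen X)
    (hP : ∀ u, ContinuousOn (fun y => P y u) X) {x : W} (hT : IsTraceClass T) :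
    singularFiber X (fun y => trace (P y ∘L T)) x ⊆
      ⋃ (u : V) (v : V), singularFiber X (fun y => inner ℂ v (P y u)) x := by
  intro ξ hξ
  by_contra! hnotMem
  simp only [Set.mem_iUnion, not_exists] at hnotMem
  rcases hξ with rfl | hξ
  · exact hnotMem 0 0 (Or.inl rfl)
  refine hξ fun φ hφ hφan hφx => exists_exp_decay_iff.2 ?_
  have hcoeff : ∀ u v, ∃ k : ℕ, ∀ _ : Unit, ∃ M : ℝ,
      ∀ p : Set.Ioi (0 : ℝ) × Metric.ball ξ (1 / (k + 1)), Real.exp (1 / (k + 1) * p.1) *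
        ‖imagFourier (fun y => inner ℂ v ((((gauss p.1 ‖x - y‖ : ℂ) * φ y) • P y) u))
          ((p.1 : ℝ) • (p.2 : ImagDual W))‖ ≤ M := by
    intro u v
    have hdecay := hnotMem u v
    simp only [singularFiber, Set.mem_ofPred_eq, not_or, not_not] at hdecay
    simpa only [smul_apply, inner_smul_right, forall_const] using
      exists_exp_decay_iff.1 (hdecay.2 φ hφ hφan hφx)
  obtain ⟨k, hdecay⟩ := exists_norm_imagFourier_trace_comp_le
    (fun _ _ p u => (hφ.mul_left (contDiff_gauss p.1 x)).integrable_smul hX (hP u))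
    (fun _ _ _ => by positivity) hcoeff hT
  exact ⟨k, by simpa only [ContinuousLinearMap.smul_comp, trace_smul] using hdecay ()⟩

end TraceFibers

section RealWavefront

variable {W : Type*} [NormedAddCommGroup W] [InnerProductSpace ℝ W] [FiniteDimensional ℝ W]
  [MeasurableSpace W] [BorelSpace W]

theorem norm_imagFourier_mulI (g : W → ℂ) (η : W →L[ℝ] ℝ) :
    ‖imagFourier g (mulI η)‖ = ((2 * Real.pi) ^ Module.finrank ℝ W)⁻¹ *
      ‖∫ y, g y * Complex.exp (-(Complex.I * (η y : ℂ)))‖ := by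
  rw [imagFourier, norm_mul, Complex.norm_real, Real.norm_of_nonneg (by positivity)]
  rfl

theorem rapidlyDecaying_imagFourier_iff {g : W → ℂ} {C : Set (ImagDual W)} :
    RapidlyDecaying (imagFourier g) C ↔ ∀ N : ℕ, ∃ A : ℝ, 0 < A ∧ ∀ η ∈ mulI ⁻¹' C,
      ‖η‖ ^ N * ‖∫ y, g y * Complex.exp (-(Complex.I * (η y : ℂ)))‖ ≤ A := by
  have hc : 0 < ((2 * Real.pi) ^ Module.finrank ℝ W)⁻¹ := by positivity
  refine forall_congr' fun N => (OrderIso.mulLeft₀ _ hc).surjective.exists.trans <|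
    exists_congr fun A => and_congr (mul_pos_iff_of_pos_left hc) ?_
  simp only [← coe_mulIEquiv, (mulIEquiv W).surjective.forall, Set.mem_preimage]
  refine forall₂_congr fun η _ => ?_
  rw [coe_mulIEquiv, norm_mulI, norm_imagFourier_mulI, mul_left_comm]
  exact mul_le_mul_iff_right₀ hc

theorem mem_realWavefrontFiber_iff {X : Set W} {f : W → ℂ} {x : W} {η : W →L[ℝ] ℝ} :
    η ∈ realWavefrontFiber X f x ↔ mulI η ∈ wavefrontFiber X f x := by
  have hzero : η = 0 ↔ mulI η = 0 := (map_eq_zero_iff _ (mulIEquiv W).injective).symm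
  have hcone (C : Set (ImagDual W)) : IsCone (mulI ⁻¹' C) ↔ IsCone C := by
    simp only [IsCone, ← coe_mulIEquiv, (mulIEquiv W).surjective.forall, Set.mem_preimage, map_smul]
  refine or_congr hzero (not_congr ((mulIEquiv W).injective.preimage_surjective.exists.trans ?_))
  refine exists_congr fun C => and_congr (mulIEquiv W).toHomeomorph.isOpen_preimage <|
    and_congr (hcone C) <| and_congr Iff.rfl <| exists_congr fun φ => ?_
  rw [rapidlyDecaying_imagFourier_iff]
  rfl

end RealWavefront

section Manifold

theorem mulI_apply_eq_iff {W W' : Type*} [AddCommGroup W] [Module ℝ W] [TopologicalSpace W]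
    [AddCommGroup W'] [Module ℝ W'] [TopologicalSpace W'] (ζ : W →L[ℝ] ℝ) (η : W' →L[ℝ] ℝ)
    (w : W) (w' : W') :
    (mulI ζ : W →L[ℝ] ℂ) w = (mulI η : W' →L[ℝ] ℂ) w' ↔ ζ w = η w' := by
  simp [mulI]

variable {n : ℕ} {M : Type*} [TopologicalSpace M] [ChartedSpace (EuclideanSpace ℝ (Fin n)) M]

theorem image_mulI_realWFAt (f : M → ℂ) (x : M) : mulI '' realWFAt (n := n) f x = WFAt f x := by
  ext ξ
  obtain ⟨ζ, rfl⟩ := (mulIEquiv _).surjective ξ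
  rw [← coe_mulIEquiv, (mulIEquiv _).injective.mem_set_image]
  refine Iff.trans ?_ (mulIEquiv (EuclideanSpace ℝ (Fin n))).surjective.exists.symm
  exact exists_congr fun η => and_congr mem_realWavefrontFiber_iff <|
    forall_congr' fun v => (mulI_apply_eq_iff ζ η v _).symm

variable {V : Type*} [NormedAddCommGroup V] [InnerProductSpace ℂ V] [CompleteSpace V]
  {P : M → V →L[ℂ] V}

theorem iUnion_WFAt_inner (hP : ∀ v, Continuous fun y => P y v) (x : M) :
    ⋃ (u : V) (v : V), WFAt (n := n) (fun y => inner ℂ v (P y u)) x =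
      ⋃ (T : V →L[ℂ] V) (_ : IsTraceClass T), WFAt (n := n) (fun y => trace (P y ∘L T)) x := by
  refine Set.Subset.antisymm (Set.iUnion₂_subset fun u v => ?_) (Set.iUnion₂_subset fun T hT => ?_)
  · simp only [← trace_comp_rankOne]
    exact Set.subset_iUnion₂_of_subset _ (isTraceClass_rankOne u v) subset_rfl
  · rintro ξ ⟨η, hη, hξ⟩
    obtain ⟨u, v, huv⟩ := Set.mem_iUnion₂.1 <| wavefrontFiber_trace_comp_subset
      (isOpen_extChartAt_target x)
      (fun u => (hP u).comp_continuousOn (continuousOn_extChartAt_symm x))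
      (mem_extChartAt_target x) hT hη
    exact Set.mem_iUnion₂.2 ⟨u, v, η, huv, hξ⟩

theorem iUnion_SSAt_inner (hP : ∀ v, Continuous fun y => P y v) (x : M) :
    ⋃ (u : V) (v : V), SSAt (n := n) (fun y => inner ℂ v (P y u)) x =
      ⋃ (T : V →L[ℂ] V) (_ : IsTraceClass T), SSAt (n := n) (fun y => trace (P y ∘L T)) x := by
  refine Set.Subset.antisymm (Set.iUnion₂_subset fun u v => ?_) (Set.iUnion₂_subset fun T hT => ?_)
  · simp only [← trace_comp_rankOne]
    exact Set.subset_iUnion₂_of_subset _ (isTraceClass_rankOne u v) subset_rfl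
  · rintro ξ ⟨η, hη, hξ⟩
    obtain ⟨u, v, huv⟩ := Set.mem_iUnion₂.1 <| singularFiber_trace_comp_subset
      (isOpen_extChartAt_target x)
      (fun u => (hP u).comp_continuousOn (continuousOn_extChartAt_symm x)) hT hη
    exact Set.mem_iUnion₂.2 ⟨u, v, η, huv, hξ⟩

end Manifold

end RepWF

open RepWF in
theorem mainTheorem6_general {n : ℕ} {M : Type*} [TopologicalSpace M]
    [ChartedSpace (EuclideanSpace ℝ (Fin n)) M]
    {V : Type*} [NormedAddCommGroup V] [InnerProductSpace ℂ V] [CompleteSpace V]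
    {P : M → V →L[ℂ] V} (hP : ∀ v, Continuous fun y => P y v) (x : M) :
    (⋃ (u : V) (v : V), WFAt (n := n) (fun y => inner ℂ v (P y u)) x =
        ⋃ (T : V →L[ℂ] V) (_ : IsTraceClass T), WFAt (fun y => trace (P y ∘L T)) x) ∧
      (⋃ (u : V) (v : V), SSAt (n := n) (fun y => inner ℂ v (P y u)) x =
        ⋃ (T : V →L[ℂ] V) (_ : IsTraceClass T), SSAt (fun y => trace (P y ∘L T)) x) ∧
      ⋃ (u : V) (v : V), WFAt (n := n) (fun y => inner ℂ v (P y u)) x =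
        mulI '' ⋃ (T : V →L[ℂ] V) (_ : IsTraceClass T), realWFAt (fun y => trace (P y ∘L T)) x := by
  refine ⟨iUnion_WFAt_inner hP x, iUnion_SSAt_inner hP x, ?_⟩
  simp only [Set.image_iUnion₂, image_mulI_realWFAt, iUnion_WFAt_inner hP x]

theorem mainTheorem6 {n : ℕ} {G : Type*} [TopologicalSpace G]
    [ChartedSpace (EuclideanSpace ℝ (Fin n)) G] [Group G] [LieGroup (𝓡 n) ω G]
    {V : Type*} [NormedAddCommGroup V] [InnerProductSpace ℂ V] [CompleteSpace V]
    (π : G →* unitary (V →L[ℂ] V))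
    (hπ : ∀ v : V, Continuous fun g : G => (π g : V →L[ℂ] V) v) :
    RepWF.WF n π = RepWF.traceWF n π ∧
      RepWF.SS n π = RepWF.traceSS n π ∧
      RepWF.WF n π = RepWF.mulI '' RepWF.howeWF n π := by
  obtain ⟨hWF, hSS, hreal⟩ := mainTheorem6_general (n := n) hπ 1
  refine ⟨congrArg closure hWF, congrArg closure hSS, ?_⟩
  exact (congrArg closure hreal).trans
    ((RepWF.mulIEquiv (GroupLieAlgebra (𝓡 n) G)).toHomeomorph.image_closure _).symm
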